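/- A rack is a set $R$ with a binary operation $*$ such that for each $b\in R$ the map $a\mapsto a*b$ is bijective and $(a*b)*c=(a*c)*(b*c)$ for all $a,b,c\in R$; it is a quandle if moreover $a*a=a$ for all $a$. The kink map $\iota:R\to R$ of a rack $R$ is characterized by $\iota(a)*a=a$ for all $a \in R$, and the associated quandle $Q_R$ is the set $R$ with the operation $a*^{\iota}b:=\iota(a)*b$. An $S^2$-knot is the (oriented) image of a smooth embedding $F:S^2\to\mathbb R^4$. Suppose that the projection $f=\pi\circ F:S^2\to\mathbb R^3$ dropping the fourth coordinate is generic, that is, every point of its image is a regular point, a transverse double point, a transverse triple point or a branch point (Whitney umbrella). The image of $f$, with the height information given by the fourth coordinate, is then called a diagram $D$ of the $S^2$-knot. Its sheets are the connected pieces obtained by cutting the surface, along the double point curves, in the lower of the two disks; that is, the connected components of $S^2$ minus the set of points that lie below another point with the same image under $f$. Each sheet has a normal direction $\vec n$ such that $(\vec v_1,\vec v_2,\vec n)$ matches the orientation of $\mathbb R^3$ whenever $(\vec v_1,\vec v_2)$ matches the orientation of the sheet. For a rack $R$, let $\mathrm{Col}_R(D)$ be the set of rack colorings of $D$ by $R$: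 maps $c$ from the set of sheets of $D$ to $R$ such that, along each double point curve, $c(x_k)=c(x_i)*c(x_j)$, where $x_j$ is the over-sheet and $x_i,x_k$ are the under-sheets such that the normal direction of $x_j$ points from $x_i$ to $x_k$. **Theorem 3.3.** For any rack $R$ and any $S^2$-knot diagram $D$ without branch points, there is a bijection between $\mathrm{Col}_R(D)$ and $\mathrm{Col}_{Q_R}(D)$. -/

import Mathlib

open scoped Manifold ContDiff Topology Quandles

noncomputable section

namespace SurfaceKnot

/-! ### Racks and the associated quandle

Mathlib's `Rack` uses the left action `b ◃ a`; the right-handed product `a * b` of knot theory is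
`b ◃ a`.  So bijectivity of `• * b` is bijectivity of `b ◃ •`, and
`(a * b) * c = (a * c) * (b * c)` is `c ◃ (b ◃ a) = (c ◃ b) ◃ (c ◃ a)`. -/

section Racks

variable {R : Type*} [Rack R]

/-- The (negative) kink map `ι`, the unique map with `ι a * a = a`, i.e. `a ◃ ι a = a`. -/
def kink (a : R) : R := a ◃⁻¹ a

theorem act_kink (a : R) : a ◃ kink a = a := Rack.right_inv a a

theorem eq_kink_iff (a b : R) : b = kink a ↔ a ◃ b = a := by
  constructor
  · rintro rfl
    exact act_kink a
  · intro h
    rw [← Rack.left_cancel a, h, act_kink]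

theorem act_kink_comm (b a : R) : b ◃ kink a = kink (b ◃ a) := by
  rw [eq_kink_iff, ← Shelf.self_distrib, act_kink]

theorem kink_act (b a : R) : kink b ◃ a = b ◃ a := Rack.self_invAct_act_eq

theorem kink_act_self (a : R) : kink (a ◃ a) = a := by
  symm
  rw [eq_kink_iff, Rack.self_act_act_eq]

theorem kink_self_act (a : R) : kink a ◃ kink a = a := by
  rw [kink_act, act_kink]

/-- The operation `a *^ι b = ι a * b` on `R`, i.e. `b` acts on `a` by `b ◃ ι a`. -/
def kinkAct (b a : R) : R := b ◃ kink a

/-- The inverse of `kinkAct b`. -/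
def kinkInvAct (b a : R) : R := (b ◃⁻¹ a) ◃ (b ◃⁻¹ a)

theorem kinkAct_distrib (x y z : R) :
    kinkAct x (kinkAct y z) = kinkAct (kinkAct x y) (kinkAct x z) := by
  simp only [kinkAct, ← act_kink_comm]
  rw [act_kink_comm x y, kink_act, ← Shelf.self_distrib]

theorem kinkInvAct_kinkAct (b a : R) : kinkInvAct b (kinkAct b a) = a := by
  simp only [kinkAct, kinkInvAct, Rack.left_inv b (kink a), kink_self_act]

theorem kinkAct_kinkInvAct (b a : R) : kinkAct b (kinkInvAct b a) = a := by
  simp only [kinkAct, kinkInvAct, kink_act_self, Rack.right_inv b a]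

end Racks

/-- The underlying set of the associated quandle `Q_R` of a rack `R`. -/
def AssociatedQuandle (R : Type*) : Type _ := R

/-- The associated quandle `Q_R` is `R` with the operation `a *^ι b = ι a * b`. -/
instance (R : Type*) [Rack R] : Quandle (AssociatedQuandle R) where
  act := kinkAct (R := R)
  self_distrib {x y z} := kinkAct_distrib (R := R) x y z
  invAct := kinkInvAct (R := R)
  left_inv := kinkInvAct_kinkAct (R := R)
  right_inv := kinkAct_kinkInvAct (R := R)
  fix {a} := act_kink (R := R) a

/-! ### `S²`-knots, generic projections and diagrams -/

/-- `E n` is Euclidean `n`-space. -/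
abbrev E (n : ℕ) : Type := EuclideanSpace ℝ (Fin n)

/-- The unit sphere in `ℝ³`, with Mathlib's smooth structure. -/
abbrev S2 : Type := Metric.sphere (0 : E 3) 1

/-- The determinant of three vectors of `ℝ³`, which gives the standard orientation of `ℝ³`. -/
def det3 (u v w : E 3) : ℝ := Matrix.det !![u 0, u 1, u 2; v 0, v 1, v 2; w 0, w 1, w 2]

/-- The differential at `x` of a map from the sphere to `ℝ³`. -/
def differential (f : S2 → E 3) (x : S2) : E 2 →L[ℝ] E 3 :=
  mfderiv (𝓡 2) 𝓘(ℝ, E 3) f x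

/-- The pair `(v₁, v₂)` of tangent vectors of the sphere at `x` is positively oriented; the sphere
is oriented as the boundary of the unit ball (outward normal first). -/
def IsPositiveFrame (x : S2) (v₁ v₂ : E 2) : Prop :=
  0 < det3 (x : E 3) (differential Subtype.val x v₁) (differential Subtype.val x v₂)

/-- `n` is a positive normal vector at `x` of the oriented surface parametrized by `f`: it is
orthogonal to the surface and `(v₁, v₂, n)` matches the orientation of `ℝ³` whenever `(v₁, v₂)`
matches the orientation of the surface. -/
def IsPositiveNormal (f : S2 → E 3) (x : S2) (n : E 3) : Prop :=
  (∀ v, inner ℝ (differential f x v) n = 0) ∧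
  ∀ v₁ v₂, IsPositiveFrame x v₁ v₂ → 0 < det3 (differential f x v₁) (differential f x v₂) n

/-- `x` is a branch point of `f` (Whitney umbrella): in suitable smooth coordinates of the sphere
around `x` and of `ℝ³` around `f x`, the map `f` is `(s, t) ↦ (s², st, t)`. -/
def IsBranchPoint (f : S2 → E 3) (x : S2) : Prop :=
  ∃ φ ∈ IsManifold.maximalAtlas (𝓡 2) ∞ S2, ∃ ψ ∈ IsManifold.maximalAtlas 𝓘(ℝ, E 3) ∞ (E 3),
    x ∈ φ.source ∧ φ x = 0 ∧ f x ∈ ψ.source ∧ ψ (f x) = 0 ∧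
    ∀ z ∈ φ.source, f z ∈ ψ.source ∧
      ψ (f z) = !₂[(φ z 0) ^ 2, φ z 0 * φ z 1, φ z 1]

/-- `f` is generic: every point of its image is a regular point, a transverse double point, a
transverse triple point, or a branch point. -/
structure IsGeneric (f : S2 → E 3) : Prop where
  contMDiff : ContMDiff (𝓡 2) 𝓘(ℝ, E 3) ∞ f
  /-- `f` is an immersion away from the branch points. -/
  regular_or_branch : ∀ x, Function.Injective (differential f x) ∨ IsBranchPoint f x
  /-- A branch point is not a multiple point. -/
  branch_unique : ∀ x y, IsBranchPoint f x → f y = f x → y = x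
  /-- Two distinct branches of the surface through a point have transverse tangent planes. -/
  transverse_two : ∀ x y, x ≠ y → f x = f y →
    (differential f x).range ⊔ (differential f y).range = ⊤
  /-- The tangent planes of three distinct branches through a point are in general position. -/
  transverse_three : ∀ x y z, x ≠ y → y ≠ z → x ≠ z → f x = f y → f y = f z →
    (differential f x).range ⊓ (differential f y).range ⊓ (differential f z).range = ⊥
  /-- There are no quadruple points. -/
  card_fiber_le : ∀ p, (f ⁻¹' {p}).encard ≤ 3

/-- The projection `ℝ⁴ → ℝ³` dropping the fourth coordinate. -/
def proj (p : E 4) : E 3 := !₂[p 0, p 1, p 2]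

/-- A diagram of an (oriented) `S²`-knot: the knot is the image of a smooth embedding of the
oriented sphere into `ℝ⁴`, it is projected generically to `ℝ³`, and the dropped fourth coordinate
is kept as height information. -/
structure Diagram where
  /-- The embedding parametrizing the knot, compatibly with its orientation. -/
  toFun : S2 → E 4
  isSmoothEmbedding : Manifold.IsSmoothEmbedding (𝓡 2) 𝓘(ℝ, E 4) ∞ toFun
  isGeneric : IsGeneric (fun x => proj (toFun x))

namespace Diagram

variable (D : Diagram)

/-- The projected surface in `ℝ³`. -/
def map (x : S2) : E 3 := proj (D.toFun x)

/-- The height over `ℝ³`. -/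
def height (x : S2) : ℝ := D.toFun x 3

/-- The diagram has no branch points. -/
def NoBranchPoints : Prop := ∀ x, ¬ IsBranchPoint D.map x

/-- The part of the surface lying below another part at a multiple point. -/
def lowerSet : Set S2 := {x | ∃ y, D.map y = D.map x ∧ D.height x < D.height y}

/-- The sheets: the connected pieces into which the surface falls when it is cut, along the double
point curves, in the lower of the two disks. -/
def Sheet : Type := ConnectedComponents (D.lowerSetᶜ : Set S2)

/-- The points of the (parametrizing) surface that lie on a sheet. -/
def Sheet.carrier {D : Diagram} (s : D.Sheet) : Set S2 :=
  {x | ∃ h : x ∈ D.lowerSetᶜ, (ConnectedComponents.mk ⟨x, h⟩ : D.Sheet) = s}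

/-- `D.Meet xi xj xk`: along some double point curve, `xj` is the over-sheet, `xi` and `xk` are the
under-sheets, and the normal direction of `xj` points from `xi` to `xk`.

Here `p` and `q` are the lower and the upper preimage of a double point (which is not a triple
point), `n` is the normal direction of the over-sheet there, and `γ` is a smooth curve on the
surface that crosses the over-sheet at time `0`, passing from `xi` to `xk` in the direction of
`n`. -/
def Meet (xi xj xk : D.Sheet) : Prop :=
  ∃ p q : S2, D.map p = D.map q ∧ D.height p < D.height q ∧
    (∀ z, D.map z = D.map p → z = p ∨ z = q) ∧ q ∈ xj.carrier ∧
    ∃ n : E 3, IsPositiveNormal D.map q n ∧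
    ∃ γ : ℝ → S2, ContMDiff 𝓘(ℝ, ℝ) (𝓡 2) ∞ γ ∧ γ 0 = p ∧
      0 < inner ℝ (deriv (fun t => D.map (γ t)) 0) n ∧
      (∀ᶠ t in 𝓝[<] (0 : ℝ), γ t ∈ xi.carrier) ∧ ∀ᶠ t in 𝓝[>] (0 : ℝ), γ t ∈ xk.carrier

/-- The set `Col_R(D)` of rack colorings: maps `c` from the set of sheets to `R` with
`c xk = c xi * c xj` along each double point curve. -/
def Col (R : Type*) [Rack R] : Set (D.Sheet → R) :=
  {c | ∀ xi xj xk, D.Meet xi xj xk → c xk = c xj ◃ c xi}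

end Diagram

end SurfaceKnot

end

open scoped Manifold ContDiff Topology Quandles

noncomputable section

namespace SurfaceKnot


/-! ### Gluing integer-valued germs over a sphere -/

section Gluing

variable {X : Type*} [TopologicalSpace X]

/-! The kink map `ι` is a permutation that commutes with every translation, and `ι b` acts exactly
as `b` does. Suppose integers `N` on the sheets grow by one across each double point curve in the
direction of the over-sheet's normal. Then twisting `c s` to `ι ^ N s (c s)` turns rack colorings by
`R` into colorings by `Q_R` and back: the extra `ι` in the operation of `Q_R` is the jump of `N`
(`mem_col_iff_twist_mem_col`).

Such `N` exists because `S²` has no nontrivial coverings (`NoBranchPoints.exists_index`). Without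
branch points the surface is immersed, so around each of its points it has a collar with a positive
side. For `w` near `x`, count the branches above `x` whose positive side contains the image of `w`.
Germs at neighbouring base points differ locally by constants (`isCoherent_indexGerm`), hence glue
to one function `M` (`exists_primitive_sphere`). Off the lower set the count is empty, so `M` is
locally constant there and descends to sheets; passing under a single branch along its normal adds
one.

Orientations become determinants: `m` points to the positive side at `y` when `addRankOne
(radialDeriv f y) y m` has positive determinant. -/

/-- A family of integer-valued germs, `N x` near `x`, is coherent if neighbouring germs differ
locally by constants. -/
def IsCoherent (N : X → X → ℤ) : Prop :=
  ∀ x, ∀ᶠ z in 𝓝 x, ∃ c, ∀ᶠ w in 𝓝 z, N x w = N z w + c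

/-- `M` agrees near `z` with the germ `N z` up to a constant. -/
def IsPrimitiveAt (N : X → X → ℤ) (M : X → ℤ) (z : X) : Prop :=
  ∃ c, ∀ᶠ w in 𝓝 z, M w = N z w + c

/-- The points at which the germ `N x` is compatible with the family. -/
def compatSet (N : X → X → ℤ) (x : X) : Set X :=
  interior {z | IsPrimitiveAt N (N x) z}

theorem IsCoherent.mem_compatSet {N : X → X → ℤ} (hN : IsCoherent N) (x : X) :
    x ∈ compatSet N x :=
  mem_interior_iff_mem_nhds.2 (hN x)

theorem IsPrimitiveAt.eventually_sub_eq {N : X → X → ℤ} {M M' : X → ℤ} {z : X}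
    (h : IsPrimitiveAt N M z) (h' : IsPrimitiveAt N M' z) :
    ∀ᶠ w in 𝓝 z, M w - M' w = M z - M' z := by
  obtain ⟨c, hc⟩ := h
  obtain ⟨c', hc'⟩ := h'
  filter_upwards [hc, hc'] with w hw hw'
  rw [hw, hw', hc.self_of_nhds, hc'.self_of_nhds]
  ring

/-- The bundle of local primitives of a coherent family of germs. -/
def primitiveBundle (N : X → X → ℤ) (hN : IsCoherent N) : FiberBundleCore X X ℤ where
  baseSet := compatSet N
  isOpen_baseSet _ := isOpen_interior
  indexAt := id
  mem_baseSet_at := hN.mem_compatSet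
  -- In chart `i`, the number `v` over `z` stands for the germ of `N i + v`; equating values at `z`
  -- gives the constant in chart `j`.
  coordChange i j z v := v + N i z - N j z
  coordChange_self _ _ _ _ := by ring
  continuousOn_coordChange i j := by
    rintro ⟨z, v⟩ ⟨⟨hi, hj⟩, -⟩
    have hi' : z ∈ {z | IsPrimitiveAt N (N i) z} := interior_subset hi
    have hj' : z ∈ {z | IsPrimitiveAt N (N j) z} := interior_subset hj
    have h := hi'.eventually_sub_eq hj'
    apply ContinuousAt.continuousWithinAt
    have h' : ∀ᶠ p : X × ℤ in 𝓝 (z, v), p.2 + (N i z - N j z) = p.2 + N i p.1 - N j p.1 := by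
      have := (continuousAt_fst : ContinuousAt Prod.fst (z, v)).eventually h
      filter_upwards [this] with p hp
      rw [← hp]; ring
    exact ContinuousAt.congr (f := fun p : X × ℤ => p.2 + (N i z - N j z)) (by fun_prop) h'
  coordChange_comp _ _ _ _ _ _ := by ring

/-- The bundle of primitives has discrete fibres, so it is a covering; simple connectivity lifts the
identity to a global section, which is locally constant in each chart. -/
theorem IsCoherent.exists_primitive [SimplyConnectedSpace X] [LocallyPathConnectedSpace X]
    {N : X → X → ℤ} (hN : IsCoherent N) : ∃ M : X → ℤ, ∀ z, IsPrimitiveAt N M z := by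
  let Z := primitiveBundle N hN
  have hcov : IsCoveringMap Z.proj :=
    IsCoveringMap.mk _ (fun _ => ℤ) (fun x => Z.localTriv x) (fun x => hN.mem_compatSet x)
  obtain ⟨x₀⟩ := (inferInstance : Nonempty X)
  obtain ⟨s, ⟨-, hs⟩, -⟩ := hcov.existsUnique_continuousMap_lifts (ContinuousMap.id X) x₀
    (⟨x₀, (0 : ℤ)⟩ : Z.TotalSpace) rfl
  have hs' : ∀ w, (s w).1 = w := fun w => congrFun hs w
  let σ : X → ℤ := fun w => (s w).2
  refine ⟨fun w => σ w + N w w, fun z => ?_⟩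
  have hz : s z ∈ (Z.localTriv z).source := by
    rw [FiberBundleCore.mem_localTriv_source, hs' z]
    exact hN.mem_compatSet z
  have hcont : ContinuousAt (fun w => (Z.localTriv z (s w)).2) z :=
    continuousAt_snd.comp
      (((Z.localTriv z).continuousAt hz).comp s.continuous.continuousAt)
  have hev : ∀ᶠ w in 𝓝 z, (Z.localTriv z (s w)).2 = (Z.localTriv z (s z)).2 :=
    hcont.preimage_mem_nhds (IsOpen.mem_nhds (isOpen_discrete {(Z.localTriv z (s z)).2}) rfl)
  refine ⟨(Z.localTriv z (s z)).2, ?_⟩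
  filter_upwards [hev] with w hw
  have h1 : (Z.localTriv z (s w)).2 = σ w + N (s w).1 (s w).1 - N z (s w).1 := rfl
  rw [← hw, h1, hs' w]
  ring

end Gluing

theorem fact_finrank_three : Fact (Module.finrank ℝ (E 3) = 2 + 1) := ⟨by simp⟩

/-- Stereographic projection from `v` moves the problem to the plane. -/
theorem IsCoherent.exists_primitive_compl_singleton {N : S2 → S2 → ℤ} (hN : IsCoherent N)
    (v : S2) : ∃ M : S2 → ℤ, ∀ z ≠ v, IsPrimitiveAt N M z := by
  have := fact_finrank_three
  let e := stereographic' 2 v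
  have hcont : Continuous e.symm := by
    rw [← continuousOn_univ]
    have := e.continuousOn_symm
    rwa [show e.target = Set.univ from stereographic'_target v] at this
  have hN' : IsCoherent (fun a b : E 2 => N (e.symm a) (e.symm b)) := by
    intro a
    filter_upwards [hcont.continuousAt.eventually (hN (e.symm a))] with b ⟨c, hc⟩
    exact ⟨c, hcont.continuousAt.eventually hc⟩
  obtain ⟨M, hM⟩ := hN'.exists_primitive
  refine ⟨fun w => M (e w), fun z hz => ?_⟩
  have hzs : z ∈ e.source := by simpa [e] using hz
  obtain ⟨c, hc⟩ := hM (e z)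
  refine ⟨c, ?_⟩
  filter_upwards [(e.continuousAt hzs).eventually hc, e.open_source.mem_nhds hzs] with w hw hws
  rw [hw, e.left_inv hzs, e.left_inv hws]

theorem isPreconnected_compl_pair (v : S2) : IsPreconnected ({v, -v}ᶜ : Set S2) := by
  have := fact_finrank_three
  let e := stereographic' 2 v
  have ht : e.target = Set.univ := stereographic'_target v
  have hsrc : e.source = {v}ᶜ := stereographic'_source v
  have hcont : Continuous e.symm := by
    rw [← continuousOn_univ, ← ht]
    exact e.continuousOn_symm
  have hv : -v ∈ e.source := by
    rw [hsrc, Set.mem_compl_singleton_iff]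
    exact fun h => ne_neg_of_mem_unit_sphere ℝ v h.symm
  have himg : ({v, -v}ᶜ : Set S2) = e.symm '' {e (-v)}ᶜ := by
    ext z
    constructor
    · intro hz
      have hz1 : z ≠ v := fun h => hz (Or.inl h)
      have hzs : z ∈ e.source := by rw [hsrc]; exact hz1
      refine ⟨e z, fun h => hz (Or.inr (e.injOn hzs hv h)), e.left_inv hzs⟩
    · rintro ⟨a, ha, rfl⟩
      have hat : a ∈ e.target := by rw [ht]; trivial
      rintro (h | h)
      · have := e.map_target hat
        rw [hsrc] at this
        exact this h
      · exact ha (by rw [Set.mem_singleton_iff, ← h, e.right_inv hat])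
  rw [himg]
  refine (IsConnected.isPreconnected ?_).image _ hcont.continuousOn
  refine (isPathConnected_compl_singleton_of_one_lt_rank ?_ _).isConnected
  rw [← Module.finrank_eq_rank]
  simp

/-- Primitives off two antipodal points differ by a constant on the overlap, which is connected, so
one can be shifted to match the other. -/
theorem IsCoherent.exists_primitive_sphere {N : S2 → S2 → ℤ} (hN : IsCoherent N) :
    ∃ M : S2 → ℤ, ∀ z, IsPrimitiveAt N M z := by
  let v : S2 := ⟨EuclideanSpace.single 0 1, by simp⟩
  obtain ⟨M₁, h₁⟩ := hN.exists_primitive_compl_singleton v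
  obtain ⟨M₂, h₂⟩ := hN.exists_primitive_compl_singleton (-v)
  have hloc : ∀ z ∈ ({v, -v}ᶜ : Set S2), ∀ᶠ w in 𝓝 z, M₁ w - M₂ w = M₁ z - M₂ z := by
    intro z hz
    simp only [Set.mem_compl_iff, Set.mem_insert_iff, Set.mem_singleton_iff, not_or] at hz
    exact (h₁ z hz.1).eventually_sub_eq (h₂ z hz.2)
  obtain ⟨k, hk⟩ : ∃ k, ∀ z ∈ ({v, -v}ᶜ : Set S2), M₁ z - M₂ z = k := by
    have hc : ContinuousOn (fun z => M₁ z - M₂ z) ({v, -v}ᶜ : Set S2) := fun z hz =>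
      ((continuousAt_const.congr
        (Filter.EventuallyEq.symm (hloc z hz))) : ContinuousAt _ z).continuousWithinAt
    rcases Set.eq_empty_or_nonempty ({v, -v}ᶜ : Set S2) with h | ⟨z₀, hz₀⟩
    · exact ⟨0, by simp [h]⟩
    · exact ⟨_, fun z hz => (isPreconnected_compl_pair v).constant hc hz hz₀⟩
  classical
  refine ⟨fun z => if z = v then M₂ z + k else M₁ z, fun z => ?_⟩
  have hvv : v ≠ -v := ne_neg_of_mem_unit_sphere ℝ v
  by_cases hz : z = v
  · subst hz
    obtain ⟨c, hc⟩ := h₂ v hvv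
    refine ⟨c + k, ?_⟩
    filter_upwards [hc, isOpen_compl_singleton.mem_nhds hvv] with w hw hwv
    split_ifs with h
    · rw [hw]; ring
    · have := hk w (by rintro (h' | h'); exacts [h h', hwv h'])
      rw [← add_assoc, ← hw]; linarith
  · obtain ⟨c, hc⟩ := h₁ z hz
    refine ⟨c, ?_⟩
    filter_upwards [hc, isOpen_compl_singleton.mem_nhds hz] with w hw hwv
    rw [if_neg (by exact hwv), hw]


/-! ### Rank one modifications of linear maps -/

section LinearAlgebra

/-- The linear map `x ↦ A x + ⟪y, x⟫ m`. -/
def addRankOne (A : E 3 →L[ℝ] E 3) (y m : E 3) : E 3 →L[ℝ] E 3 :=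
  A + (innerSL ℝ y).smulRight m

@[simp]
theorem addRankOne_apply (A : E 3 →L[ℝ] E 3) (y m x : E 3) :
    addRankOne A y m x = A x + (inner ℝ y x) • m := by
  simp [addRankOne]

theorem det_id_addRankOne (y m : E 3) :
    (addRankOne (ContinuousLinearMap.id ℝ (E 3)) y m).det = 1 + inner ℝ y m := by
  have : ((addRankOne (ContinuousLinearMap.id ℝ (E 3)) y m : E 3 →L[ℝ] E 3) : E 3 →ₗ[ℝ] E 3) =
      LinearMap.transvection (innerSL ℝ y : E 3 →L[ℝ] ℝ).toLinearMap m := by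
    ext x : 1
    simp [LinearMap.transvection]
  rw [ContinuousLinearMap.det, this, LinearMap.transvection.det]
  simp

theorem det_comp (A B : E 3 →L[ℝ] E 3) : (A ∘L B).det = A.det * B.det :=
  LinearMap.det_comp (A : E 3 →ₗ[ℝ] E 3) B

/-- The modification by `n` is the one by `m` composed with the map that sends `y` to `w` and fixes
the orthogonal complement of `y`; the latter has determinant `⟪y, w⟫`. This compares two transverse
directions. -/
theorem det_addRankOne_of_apply_eq {A : E 3 →L[ℝ] E 3} {y m n w : E 3}
    (hy : ‖y‖ = 1) (hA : A y = 0) (hw : addRankOne A y m w = n) :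
    (addRankOne A y n).det = (addRankOne A y m).det * inner ℝ y w := by
  have hyy : inner ℝ y y = (1 : ℝ) := by rw [real_inner_self_eq_norm_sq, hy]; norm_num
  have h : addRankOne A y n =
      addRankOne A y m ∘L addRankOne (ContinuousLinearMap.id ℝ (E 3)) y (w - y) := by
    ext1 x
    rw [ContinuousLinearMap.comp_apply, addRankOne_apply (ContinuousLinearMap.id ℝ (E 3)),
      map_add, map_smul, map_sub, hw, addRankOne_apply, addRankOne_apply, addRankOne_apply, hA,
      hyy, ContinuousLinearMap.id_apply]
    module
  rw [h, det_comp, det_id_addRankOne, inner_sub_right, hyy]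
  ring

theorem exists_addRankOne_det_pos {A : E 3 →L[ℝ] E 3} {y : E 3} (hy : ‖y‖ = 1) (hA : A y = 0)
    (hinj : ∀ a, inner ℝ y a = (0 : ℝ) → A a = 0 → a = 0) :
    ∃ m, 0 < (addRankOne A y m).det := by
  have hyy : inner ℝ y y = (1 : ℝ) := by rw [real_inner_self_eq_norm_sq, hy]; norm_num
  have hy0 : y ≠ 0 := by rintro rfl; simp at hy
  -- `A` kills `y`, so it is not injective and hence not surjective; any `m` outside its image is
  -- transverse.
  obtain ⟨m, hm⟩ : ∃ m, ∀ x, A x ≠ m := by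
    by_contra! h
    have : Function.Injective A :=
      (LinearMap.injective_iff_surjective (f := (A : E 3 →ₗ[ℝ] E 3))).2 h
    exact hy0 (this (by rw [hA, map_zero]))
  have hdet : (addRankOne A y m).det ≠ 0 := by
    intro h
    have hker := LinearMap.bot_lt_ker_of_det_eq_zero
      (f := (addRankOne A y m : E 3 →ₗ[ℝ] E 3)) h
    obtain ⟨x, hx, hx0⟩ := (Submodule.ne_bot_iff _).1 hker.ne'
    have hx' : A x + (inner ℝ y x) • m = 0 := by
      rw [← addRankOne_apply]; exact hx
    by_cases hyx : inner ℝ y x = (0 : ℝ)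
    · rw [hyx, zero_smul, add_zero] at hx'
      exact hx0 (hinj x hyx hx')
    · refine hm (-(inner ℝ y x : ℝ)⁻¹ • x) ?_
      rw [map_smul, eq_neg_of_add_eq_zero_left hx', smul_neg, neg_smul, neg_neg, smul_smul,
        inv_mul_cancel₀ hyx, one_smul]
  rcases hdet.lt_or_gt with h | h
  · refine ⟨-m, ?_⟩
    rw [det_addRankOne_of_apply_eq (m := m) (w := -y) hy hA, inner_neg_right, hyy]
    · linarith
    · rw [addRankOne_apply, map_neg, hA, inner_neg_right, hyy]; simp
  · exact ⟨m, h⟩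

theorem det3_map (B : E 3 →L[ℝ] E 3) (u v w : E 3) :
    det3 (B u) (B v) (B w) = B.det * det3 u v w := by
  have h : ∀ u v w : E 3,
      det3 u v w = (EuclideanSpace.basisFun (Fin 3) ℝ).toBasis.det ![u, v, w] := by
    intro u v w
    rw [Module.Basis.det_apply, det3, ← Matrix.det_transpose]
    congr 1
    ext i j
    fin_cases i <;> fin_cases j <;> rfl
  have h' : ![B u, B v, B w] = (B : E 3 →ₗ[ℝ] E 3) ∘ ![u, v, w] := by
    ext1 i
    fin_cases i <;> rfl
  rw [h, h, h', Module.Basis.det_comp]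

theorem det3_rotate (u v w : E 3) : det3 u v w = det3 v w u := by
  simp only [det3, Matrix.det_fin_three, Matrix.of_apply, Matrix.cons_val', Matrix.cons_val_zero,
    Matrix.cons_val_one, Matrix.cons_val]
  ring

theorem exists_orthogonal_det3_pos {y : E 3} (hy : y ≠ 0) :
    ∃ a b : E 3, inner ℝ y a = (0 : ℝ) ∧ inner ℝ y b = (0 : ℝ) ∧ 0 < det3 y a b := by
  have key : ∀ p q r : ℝ, inner ℝ y !₂[p, q, r] = y 0 * p + y 1 * q + y 2 * r := by
    intro p q r
    simp [PiLp.inner_apply, Fin.sum_univ_three, mul_comm]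
  have hdet : ∀ p q r p' q' r' : ℝ, det3 y !₂[p, q, r] !₂[p', q', r'] =
      y 0 * q * r' - y 0 * r * q' - y 1 * p * r' + y 1 * r * p' + y 2 * p * q' - y 2 * q * p' := by
    intro p q r p' q' r'
    simp [det3, Matrix.det_fin_three]
  by_cases h : y 0 = 0 ∧ y 1 = 0
  · have h2 : y 2 ≠ 0 := by
      intro h2
      apply hy
      ext i
      fin_cases i
      exacts [h.1, h.2, h2]
    refine ⟨!₂[1, 0, 0], !₂[0, y 2, 0], ?_, ?_, ?_⟩
    · rw [key, h.1]; ring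
    · rw [key, h.2]; ring
    · rw [hdet]
      have := mul_self_pos.2 h2
      linarith
  -- The second vector is the cross product of `y` with the first, so the determinant is its squared
  -- norm.
  · refine ⟨!₂[-y 1, y 0, 0], !₂[-(y 2 * y 0), -(y 2 * y 1), y 0 * y 0 + y 1 * y 1], ?_, ?_, ?_⟩
    · rw [key]; ring
    · rw [key]; ring
    · rw [hdet]
      have h0 : 0 < y 0 * y 0 + y 1 * y 1 := by
        rcases not_and_or.1 h with h | h
        · have := mul_self_pos.2 h
          have := mul_self_nonneg (y 1)
          linarith
        · have := mul_self_pos.2 h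
          have := mul_self_nonneg (y 0)
          linarith
      nlinarith [mul_pos h0 h0, mul_nonneg (mul_self_nonneg (y 2)) h0.le]

end LinearAlgebra

/-! ### The radial extension of a map on the sphere -/

section RadialExtension

/-- The extension of a map on the unit sphere that is constant along rays. -/
def radialExtension (f : S2 → E 3) (X : E 3) : E 3 :=
  if h : X = 0 then 0 else f ⟨‖X‖⁻¹ • X, by simp [norm_smul, h]⟩

variable {f : S2 → E 3}

theorem coe_ne_zero (y : S2) : (y : E 3) ≠ 0 := ne_zero_of_mem_unit_sphere y

theorem norm_coe (y : S2) : ‖(y : E 3)‖ = 1 := norm_eq_of_mem_sphere y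

theorem radialExtension_coe (f : S2 → E 3) (y : S2) : radialExtension f y = f y := by
  rw [radialExtension, dif_neg (coe_ne_zero y)]
  congr 1
  ext1
  simp

theorem radialExtension_smul (f : S2 → E 3) {t : ℝ} (ht : 0 < t) (y : S2) :
    radialExtension f (t • (y : E 3)) = f y := by
  rw [radialExtension, dif_neg (smul_ne_zero ht.ne' (coe_ne_zero y))]
  congr 1
  ext1
  simp [norm_smul, abs_of_pos ht, smul_smul, ht.ne']

theorem contDiffAt_radialExtension (hf : ContMDiff (𝓡 2) 𝓘(ℝ, E 3) ∞ f) {X : E 3} (hX : X ≠ 0) :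
    ContDiffAt ℝ ∞ (radialExtension f) X := by
  have := fact_finrank_three
  let U : TopologicalSpace.Opens (E 3) := ⟨{0}ᶜ, isOpen_compl_singleton⟩
  have hU : ∀ x : U, (x : E 3) ≠ 0 := fun x => x.2
  have h1 : ContMDiff 𝓘(ℝ, E 3) 𝓘(ℝ, E 3) ∞ (fun x : U => ‖(x : E 3)‖⁻¹ • (x : E 3)) := by
    intro x
    rw [contMDiffAt_subtype_iff (f := fun x : E 3 => ‖x‖⁻¹ • x), contMDiffAt_iff_contDiffAt]
    exact ((contDiffAt_norm ℝ (hU x)).inv (norm_ne_zero_iff.2 (hU x))).smul contDiffAt_id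
  have h2 := ContMDiff.codRestrict_sphere (n := 2) h1
    (fun x => by simp [norm_smul, hU x])
  have h3 := (hf.comp h2).contMDiffAt (x := (⟨X, hX⟩ : U))
  rw [← contMDiffAt_iff_contDiffAt]
  refine (contMDiffAt_subtype_iff (U := U) (f := radialExtension f) (x := ⟨X, hX⟩)).1 ?_
  refine h3.congr_of_eventuallyEq (Filter.Eventually.of_forall fun x => ?_)
  exact dif_neg (hU x)

/-- The derivative of the radial extension of `f`. -/
def radialDeriv (f : S2 → E 3) (X : E 3) : E 3 →L[ℝ] E 3 := fderiv ℝ (radialExtension f) X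

theorem hasStrictFDerivAt_radialExtension (hf : ContMDiff (𝓡 2) 𝓘(ℝ, E 3) ∞ f) {X : E 3}
    (hX : X ≠ 0) : HasStrictFDerivAt (radialExtension f) (radialDeriv f X) X :=
  (contDiffAt_radialExtension hf hX).hasStrictFDerivAt (by simp)

theorem continuousAt_radialDeriv (hf : ContMDiff (𝓡 2) 𝓘(ℝ, E 3) ∞ f) {X : E 3}
    (hX : X ≠ 0) : ContinuousAt (radialDeriv f) X :=
  ((contDiffAt_radialExtension hf hX).fderiv_right (m := 0) (by simp)).continuousAt

theorem radialDeriv_self (hf : ContMDiff (𝓡 2) 𝓘(ℝ, E 3) ∞ f) (y : S2) :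
    radialDeriv f y (y : E 3) = 0 := by
  have h := (hasStrictFDerivAt_radialExtension hf (coe_ne_zero y)).hasFDerivAt
  have hg : HasDerivAt (fun t : ℝ => t • (y : E 3)) (y : E 3) 1 := by
    simpa using (hasDerivAt_id (1 : ℝ)).smul_const (y : E 3)
  have h1 := HasFDerivAt.comp_hasDerivAt (1 : ℝ) (by simpa using h) hg
  have h2 : HasDerivAt (fun _ : ℝ => f y) 0 1 := hasDerivAt_const _ _
  refine h1.unique (h2.congr_of_eventuallyEq ?_)
  filter_upwards [lt_mem_nhds (zero_lt_one' ℝ)] with t ht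
  exact radialExtension_smul f ht y

/-- Chain rule for `f` as its radial extension after the inclusion; it trades manifold differentials
for Fréchet derivatives. -/
theorem radialDeriv_comp_differential (hf : ContMDiff (𝓡 2) 𝓘(ℝ, E 3) ∞ f) (y : S2) (v : E 2) :
    radialDeriv f y (differential Subtype.val y v) = differential f y v := by
  have := fact_finrank_three
  have h : f = radialExtension f ∘ Subtype.val := funext fun y => (radialExtension_coe f y).symm
  have hF := (hasStrictFDerivAt_radialExtension hf (coe_ne_zero y)).hasFDerivAt
  have hval : MDifferentiableAt (𝓡 2) 𝓘(ℝ, E 3) (Subtype.val : S2 → E 3) y :=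
    (contMDiff_coe_sphere (m := ∞) (n := 2)).mdifferentiable (by simp) y
  have hc := mfderiv_comp y hF.hasMFDerivAt.mdifferentiableAt hval
  rw [← h, hF.hasMFDerivAt.mfderiv] at hc
  rw [differential, differential, hc]
  rfl

theorem exists_differential_val_eq {y : S2} {a : E 3} (ha : inner ℝ (y : E 3) a = (0 : ℝ)) :
    ∃ v, differential Subtype.val y v = a := by
  have := fact_finrank_three
  have h := range_mvfderiv_subtypeVal (n := 2) y
  have ha' : a ∈ (Submodule.span ℝ {(y : E 3)})ᗮ :=
    Submodule.mem_orthogonal_singleton_iff_inner_right.2 ha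
  rw [← h] at ha'
  exact ha'

theorem radialDeriv_injective (hf : ContMDiff (𝓡 2) 𝓘(ℝ, E 3) ∞ f) {y : S2}
    (hinj : Function.Injective (differential f y)) (a : E 3)
    (ha : inner ℝ (y : E 3) a = (0 : ℝ)) (h : radialDeriv f y a = 0) : a = 0 := by
  obtain ⟨v, rfl⟩ := exists_differential_val_eq ha
  rw [radialDeriv_comp_differential hf] at h
  rw [hinj (h.trans (map_zero _).symm), map_zero]

/-- The modified derivative sends a positive frame `(y, a, b)` to `n` followed by the images of `a`
and `b`, again a positive frame. -/
theorem IsPositiveNormal.det_pos (hf : ContMDiff (𝓡 2) 𝓘(ℝ, E 3) ∞ f) {y : S2} {n : E 3}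
    (hn : IsPositiveNormal f y n) : 0 < (addRankOne (radialDeriv f y) y n).det := by
  obtain ⟨a, b, ha, hb, hab⟩ := exists_orthogonal_det3_pos (coe_ne_zero y)
  have hB := det3_map (addRankOne (radialDeriv f y) y n) y a b
  obtain ⟨v, rfl⟩ := exists_differential_val_eq ha
  obtain ⟨w, rfl⟩ := exists_differential_val_eq hb
  rw [addRankOne_apply, addRankOne_apply, addRankOne_apply, radialDeriv_self hf,
    radialDeriv_comp_differential hf, radialDeriv_comp_differential hf, ha, hb,
    real_inner_self_eq_norm_sq, norm_coe, one_pow, one_smul, zero_smul, zero_add,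
    add_zero, add_zero, det3_rotate] at hB
  have h := hn.2 v w hab
  rw [hB] at h
  exact pos_of_mul_pos_left h hab.le

/-- Write `v` as the image of `w` under the modification by `n`. Tangential parts are orthogonal to
`n`, so `⟪v, n⟫` is `⟪y, w⟫ ‖n‖²`, and `⟪y, w⟫` is also the ratio of the determinants. -/
theorem IsPositiveNormal.det_pos_of_inner_pos (hf : ContMDiff (𝓡 2) 𝓘(ℝ, E 3) ∞ f) {y : S2}
    {n v : E 3} (hn : IsPositiveNormal f y n) (hv : 0 < inner ℝ v n) :
    0 < (addRankOne (radialDeriv f y) y v).det := by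
  have hdet := hn.det_pos hf
  let e := (addRankOne (radialDeriv f y) y n).toContinuousLinearEquivOfDetNeZero hdet.ne'
  have hw : addRankOne (radialDeriv f y) y n (e.symm v) = v := e.apply_symm_apply v
  rw [det_addRankOne_of_apply_eq (norm_coe y) (radialDeriv_self hf y) hw]
  refine mul_pos hdet ?_
  set w := e.symm v
  obtain ⟨u, hu⟩ := exists_differential_val_eq (y := y)
    (a := w - (inner ℝ (y : E 3) w : ℝ) • (y : E 3))
    (by rw [inner_sub_right, inner_smul_right, real_inner_self_eq_norm_sq, norm_coe]; ring)
  have h0 : inner ℝ (radialDeriv f y w) n = (0 : ℝ) := by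
    have := hn.1 u
    rwa [← radialDeriv_comp_differential hf, hu, map_sub, map_smul, radialDeriv_self hf,
      smul_zero, sub_zero] at this
  rw [← hw, addRankOne_apply, inner_add_left, h0, zero_add, inner_smul_left] at hv
  exact pos_of_mul_pos_left hv real_inner_self_nonneg

end RadialExtension


/-! ### Collars of the immersed surface and their sides -/

section Collar

variable {f : S2 → E 3}

/-- The map thickening the surface `f` in the direction `m`. -/
def collarMap (f : S2 → E 3) (m X : E 3) : E 3 :=
  radialExtension f X + ((‖X‖ ^ 2 - 1) / 2) • m

theorem collarMap_coe (f : S2 → E 3) (m : E 3) (y : S2) : collarMap f m y = f y := by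
  simp [collarMap, radialExtension_coe]

theorem hasStrictFDerivAt_collarMap (hf : ContMDiff (𝓡 2) 𝓘(ℝ, E 3) ∞ f) (m : E 3) {X : E 3}
    (hX : X ≠ 0) :
    HasStrictFDerivAt (collarMap f m) (addRankOne (radialDeriv f X) X m) X := by
  have h := (((hasStrictFDerivAt_norm_sq X).sub_const 1).mul_const (2⁻¹ : ℝ)).smul_const m
  refine ((hasStrictFDerivAt_radialExtension hf hX).add h).congr_fderiv ?_
  ext1 x
  simp

/-- `e` is a collar of the surface `f` at `y` in the positive transverse direction `m`. -/
structure IsCollar (f : S2 → E 3) (y : S2) (m : E 3) (e : OpenPartialHomeomorph (E 3) (E 3)) :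
    Prop where
  mem_source : (y : E 3) ∈ e.source
  coe_eq : ⇑e = collarMap f m
  det_pos : 0 < (addRankOne (radialDeriv f y) y m).det

/-- Inverse function theorem for `collarMap` at `y`. -/
theorem exists_isCollar (hf : ContMDiff (𝓡 2) 𝓘(ℝ, E 3) ∞ f) {y : S2}
    (hinj : Function.Injective (differential f y)) : ∃ m e, IsCollar f y m e := by
  obtain ⟨m, hm⟩ := exists_addRankOne_det_pos (norm_coe y) (radialDeriv_self hf y)
    (radialDeriv_injective hf hinj)
  have h : HasStrictFDerivAt (collarMap f m)
      ((addRankOne (radialDeriv f y) y m).toContinuousLinearEquivOfDetNeZero hm.ne' :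
        E 3 →L[ℝ] E 3) y := by
    simpa using hasStrictFDerivAt_collarMap hf m (coe_ne_zero y)
  exact ⟨m, h.toOpenPartialHomeomorph _, h.mem_toOpenPartialHomeomorph_source, rfl, hm⟩

/-- The function whose sign tells on which side of the surface a point of a collar lies. -/
def side (e : OpenPartialHomeomorph (E 3) (E 3)) (P : E 3) : ℝ := ‖e.symm P‖ ^ 2 - 1

variable {y : S2} {m : E 3} {e : OpenPartialHomeomorph (E 3) (E 3)}

namespace IsCollar

theorem apply_coe (h : IsCollar f y m e) (u : S2) : e u = f u := by
  rw [h.coe_eq, collarMap_coe]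

theorem symm_apply (h : IsCollar f y m e) {u : S2} (hu : (u : E 3) ∈ e.source) :
    e.symm (f u) = u := by
  rw [← h.apply_coe u, e.left_inv hu]

theorem mem_target (h : IsCollar f y m e) {u : S2} (hu : (u : E 3) ∈ e.source) :
    f u ∈ e.target := by
  rw [← h.apply_coe u]; exact e.map_source hu

theorem side_apply (h : IsCollar f y m e) {u : S2} (hu : (u : E 3) ∈ e.source) :
    side e (f u) = 0 := by
  rw [side, h.symm_apply hu, norm_coe]; norm_num

theorem injOn (h : IsCollar f y m e) {u v : S2} (hu : (u : E 3) ∈ e.source)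
    (hv : (v : E 3) ∈ e.source) (huv : f u = f v) : u = v :=
  Subtype.ext (by rw [← h.symm_apply hu, huv, h.symm_apply hv])

theorem continuousAt_side (e : OpenPartialHomeomorph (E 3) (E 3)) {P : E 3} (hP : P ∈ e.target) :
    ContinuousAt (side e) P :=
  ((e.continuousAt_symm hP).norm.pow 2).sub_const 1

/-- The derivative is `v ↦ 2 ⟪u, w⟫`, with `w` the preimage of `v` under the derivative of the
collar; `⟪u, w⟫` is the ratio of the determinants for `v` and `m`. -/
theorem hasStrictFDerivAt_side (hf : ContMDiff (𝓡 2) 𝓘(ℝ, E 3) ∞ f) (h : IsCollar f y m e)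
    {u : S2} (hu : (u : E 3) ∈ e.source) (hdet : 0 < (addRankOne (radialDeriv f u) u m).det) :
    ∃ L : E 3 →L[ℝ] ℝ, HasStrictFDerivAt (side e) L (f u) ∧
      ∀ v, 0 < (addRankOne (radialDeriv f u) u v).det → 0 < L v := by
  let B := (addRankOne (radialDeriv f u) u m).toContinuousLinearEquivOfDetNeZero hdet.ne'
  have he : HasStrictFDerivAt e (B : E 3 →L[ℝ] E 3) (e.symm (f u)) := by
    rw [h.symm_apply hu, h.coe_eq]
    simpa [B] using hasStrictFDerivAt_collarMap hf m (coe_ne_zero u)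
  have hs := e.hasStrictFDerivAt_symm (h.mem_target hu) he
  have hn := (hasStrictFDerivAt_norm_sq (e.symm (f u))).comp (f u) hs
  refine ⟨_, hn.sub_const 1, fun v hv => ?_⟩
  have hw : addRankOne (radialDeriv f u) u m (B.symm v) = v := B.apply_symm_apply v
  rw [det_addRankOne_of_apply_eq (norm_coe u) (radialDeriv_self hf u) hw] at hv
  have hpos := pos_of_mul_pos_right hv hdet.le
  rw [h.symm_apply hu]
  simpa using hpos

end IsCollar

/-- A function vanishing on the sphere and increasing in the radial direction has the sign of
`‖X‖ - 1`. -/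
theorem eventually_pos_iff_one_lt_norm {H : E 3 → ℝ} {L : E 3 →L[ℝ] ℝ} {y : S2}
    (hH : HasStrictFDerivAt H L y) (hL : 0 < L y) (h0 : ∀ᶠ u : S2 in 𝓝 y, H u = 0) :
    ∀ᶠ X in 𝓝 (y : E 3), 0 < H X ↔ 1 < ‖X‖ := by
  have hρ : ContinuousAt (fun X : E 3 => ‖X‖⁻¹ • X) (y : E 3) :=
    (continuousAt_id.norm.inv₀ (by simp)).smul continuousAt_id
  have hρy : ‖(y : E 3)‖⁻¹ • (y : E 3) = y := by simp
  have hρ' : Filter.Tendsto (fun X : E 3 => ‖X‖⁻¹ • X) (𝓝 (y : E 3)) (𝓝 (y : E 3)) := by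
    simpa [ContinuousAt, hρy] using hρ
  -- Strict differentiability compares `X` with its radial projection, where `H` vanishes. The main
  -- term is `‖X‖ - 1` times more than `L y / 2`, and the error is at most `L y / 2` times `|‖X‖ -
  -- 1|`.
  have hdiff := (hH.isLittleO.def (half_pos hL))
  have h1 := (continuousAt_id.tendsto.prodMk_nhds hρ').eventually hdiff
  have h2 : ∀ᶠ X in 𝓝 (y : E 3), L y / 2 < L (‖X‖⁻¹ • X) :=
    hρ'.eventually (L.continuous.continuousAt.eventually (lt_mem_nhds (half_lt_self hL)))
  have h3 : ∀ᶠ X in 𝓝 (y : E 3), ∀ h : X ∈ Metric.sphere (0 : E 3) 1, H X = 0 := by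
    rw [nhds_subtype_eq_comap, Filter.eventually_comap] at h0
    filter_upwards [h0] with X hX h
    exact hX ⟨X, h⟩ rfl
  filter_upwards [h1, h2, hρ'.eventually h3, isOpen_compl_singleton.mem_nhds (coe_ne_zero y)]
    with X h1 h2 h3 hX
  have hX' : ‖X‖ ≠ 0 := norm_ne_zero_iff.2 hX
  have hn : ‖‖X‖⁻¹ • X‖ = 1 := by rw [norm_smul, norm_inv, norm_norm, inv_mul_cancel₀ hX']
  have hsub : X - ‖X‖⁻¹ • X = (‖X‖ - 1) • (‖X‖⁻¹ • X) := by
    rw [sub_smul, smul_smul, mul_inv_cancel₀ hX', one_smul, one_smul]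
  simp only [id] at h1
  rw [h3 (by simpa using hn), hsub, map_smul, norm_smul, hn, mul_one, smul_eq_mul, sub_zero,
    Real.norm_eq_abs, Real.norm_eq_abs, abs_le] at h1
  constructor
  · intro h
    by_contra! hle
    rw [abs_of_nonpos (by linarith)] at h1
    nlinarith
  · intro h
    rw [abs_of_pos (by linarith)] at h1
    nlinarith

/-- Collars at neighbouring points of the surface define the same sides. -/
theorem IsCollar.eventually_side_pos_iff (hf : ContMDiff (𝓡 2) 𝓘(ℝ, E 3) ∞ f)
    (h : IsCollar f y m e) :
    ∀ᶠ y' in 𝓝 y, ∀ m' e', IsCollar f y' m' e' →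
      ∀ᶠ P in 𝓝 (f y'), 0 < side e P ↔ 0 < side e' P := by
  have hsrc : ∀ᶠ y' : S2 in 𝓝 y, (y' : E 3) ∈ e.source :=
    continuous_subtype_val.continuousAt.eventually (e.open_source.mem_nhds h.mem_source)
  have hdet : ∀ᶠ y' : S2 in 𝓝 y, 0 < (addRankOne (radialDeriv f y') y' m).det := by
    have hA : ContinuousAt (fun y' : S2 => radialDeriv f y') y :=
      (continuousAt_radialDeriv hf (coe_ne_zero y)).comp continuous_subtype_val.continuousAt
    have hB : ContinuousAt (fun y' : S2 => (innerSL ℝ (y' : E 3)).smulRight m) y :=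
      ((ContinuousLinearMap.smulRightL ℝ (E 3) (E 3)).flip m).continuous.continuousAt.comp
        ((innerSL ℝ).continuous.comp continuous_subtype_val).continuousAt
    exact (ContinuousLinearMap.continuous_det.continuousAt.comp (hA.add hB)).eventually
      (lt_mem_nhds h.det_pos)
  filter_upwards [hsrc.eventually_nhds, hdet] with y' hy' hdet' m' e' h'
  obtain ⟨L, hL, hLpos⟩ := h.hasStrictFDerivAt_side hf hy'.self_of_nhds hdet'
  rw [← collarMap_coe f m' y'] at hL
  -- Read in the collar `e'`, the function `side e` vanishes on the sphere and has radial derivative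
  -- `L m' > 0`, so its sign is that of `‖X‖ - 1`.
  have hH := hL.comp (y' : E 3) (hasStrictFDerivAt_collarMap hf m' (coe_ne_zero y'))
  have hpos := eventually_pos_iff_one_lt_norm hH (by
      have := hLpos m' h'.det_pos
      simpa [radialDeriv_self hf] using this)
    (by
      filter_upwards [hy'] with u hu
      rw [collarMap_coe, h.side_apply hu])
  have ht : Filter.Tendsto e'.symm (𝓝 (f y')) (𝓝 (y' : E 3)) := by
    have := e'.continuousAt_symm (h'.mem_target h'.mem_source)
    rwa [ContinuousAt, h'.symm_apply h'.mem_source] at this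
  filter_upwards [ht.eventually hpos,
    e'.open_target.mem_nhds (h'.mem_target h'.mem_source)] with P hP hPt
  rw [← h'.coe_eq, e'.right_inv hPt] at hP
  rw [hP, side, sub_pos, one_lt_sq_iff₀ (norm_nonneg _)]

theorem IsCollar.eventually_side_pos_of_hasDerivAt (hf : ContMDiff (𝓡 2) 𝓘(ℝ, E 3) ∞ f)
    (h : IsCollar f y m e) {n : E 3} (hn : IsPositiveNormal f y n) {g : ℝ → E 3} {v : E 3}
    (hg : HasDerivAt g v 0) (hg0 : g 0 = f y) (hv : 0 < inner ℝ v n) :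
    (∀ᶠ t in 𝓝[>] (0 : ℝ), 0 < side e (g t)) ∧ ∀ᶠ t in 𝓝[<] (0 : ℝ), ¬ 0 < side e (g t) := by
  obtain ⟨L, hL, hLpos⟩ := h.hasStrictFDerivAt_side hf h.mem_source h.det_pos
  rw [← hg0] at hL
  have hd := hL.hasFDerivAt.comp_hasDerivAt (0 : ℝ) hg
  have hpos := hLpos v (hn.det_pos_of_inner_pos hf hv)
  have h0 : side e (g 0) = 0 := by rw [hg0, h.side_apply h.mem_source]
  have hs := (hasDerivAt_iff_tendsto_slope.1 hd).eventually (lt_mem_nhds hpos)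
  constructor
  · filter_upwards [hs.filter_mono (nhdsWithin_mono _ fun t (ht : 0 < t) => ht.ne'),
      self_mem_nhdsWithin] with t ht (ht0 : 0 < t)
    rw [slope_def_field, Function.comp_apply, Function.comp_apply, h0, sub_zero, sub_zero] at ht
    exact (div_pos_iff_of_pos_right ht0).1 ht
  · filter_upwards [hs.filter_mono (nhdsWithin_mono _ fun t (ht : t < 0) => ht.ne),
      self_mem_nhdsWithin] with t ht (ht0 : t < 0)
    rw [slope_def_field, Function.comp_apply, Function.comp_apply, h0, sub_zero, sub_zero] at ht
    intro hlt
    exact absurd ht (div_neg_of_pos_of_neg hlt ht0).not_gt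

end Collar

/-! ### The index germs -/

section IndexGerm

variable {f : S2 → E 3} {ht : S2 → ℝ}

/-- The points of the surface lying above `x`. -/
def above (f : S2 → E 3) (ht : S2 → ℝ) (x : S2) : Set S2 := {y | f y = f x ∧ ht x < ht y}

open Classical in
/-- The number of branches above `x` whose positive side contains the point over `w`. -/
def indexGerm (e : S2 → OpenPartialHomeomorph (E 3) (E 3)) (hfin : ∀ x, (above f ht x).Finite)
    (x w : S2) : ℤ :=
  ∑ y ∈ (hfin x).toFinset, if 0 < side (e y) (f w) then 1 else 0

/-- Compactness of `Wᶜ` reduces this to pairs near `(x, y₀)`. Different images and smaller height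
are open conditions; when `y₀ = x`, local injectivity of `f` excludes nearby pairs. -/
theorem eventually_above_subset {m : S2 → E 3} {e : S2 → OpenPartialHomeomorph (E 3) (E 3)}
    (hf : Continuous f) (hht : Continuous ht) (hemb : ∀ x y, f x = f y → ht x = ht y → x = y)
    (he : ∀ y, IsCollar f y (m y) (e y)) {x : S2} {W : Set S2} (hW : IsOpen W)
    (hxW : above f ht x ⊆ W) : ∀ᶠ z in 𝓝 x, above f ht z ⊆ W := by
  have key : ∀ y₀ ∈ Wᶜ, ∀ᶠ p : S2 × S2 in 𝓝 (x, y₀), p.2 ∉ above f ht p.1 := by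
    intro y₀ hy₀
    by_cases h1 : f y₀ = f x
    · rcases lt_trichotomy (ht x) (ht y₀) with h2 | h2 | h2
      · exact absurd (hxW ⟨h1, h2⟩) hy₀
      · obtain rfl := hemb y₀ x h1 h2.symm
        have hs : ∀ᶠ u : S2 in 𝓝 y₀, (u : E 3) ∈ (e y₀).source :=
          continuous_subtype_val.continuousAt.eventually
            ((e y₀).open_source.mem_nhds (he y₀).mem_source)
        rw [nhds_prod_eq]
        filter_upwards [hs.prod_mk hs] with p ⟨hp1, hp2⟩ ⟨hp, hlt⟩
        rw [(he y₀).injOn hp2 hp1 hp] at hlt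
        exact lt_irrefl _ hlt
      · have hc : ∀ᶠ p : S2 × S2 in 𝓝 (x, y₀), ht p.2 < ht p.1 :=
          ((hht.comp continuous_snd).continuousAt).eventually_lt
            ((hht.comp continuous_fst).continuousAt) h2
        filter_upwards [hc] with p hp hp'
        exact hp'.2.not_gt hp
    · have hc : ∀ᶠ p : S2 × S2 in 𝓝 (x, y₀), f p.2 ≠ f p.1 :=
        (isOpen_ne_fun (hf.comp continuous_snd) (hf.comp continuous_fst)).mem_nhds h1
      filter_upwards [hc] with p hp hp'
      exact hp hp'.1
  filter_upwards [hW.isClosed_compl.isCompact.eventually_forall_of_forall_eventually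
    (P := fun z y => y ∉ above f ht z) key]
    with z hz y hy
  by_contra hyW
  exact hz y hyW hy

theorem IsCollar.eventually_side_eq_zero_imp {y : S2} {m : E 3}
    {e : OpenPartialHomeomorph (E 3) (E 3)} (h : IsCollar f y m e) {W : Set S2} (hW : W ∈ 𝓝 y) :
    ∀ᶠ P in 𝓝 (f y), P ∈ e.target ∧ (side e P = 0 → ∃ u ∈ W, f u = P) := by
  have ht : Filter.Tendsto e.symm (𝓝 (f y)) (𝓝 (y : E 3)) := by
    have := e.continuousAt_symm (h.mem_target h.mem_source)
    rwa [ContinuousAt, h.symm_apply h.mem_source] at this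
  rw [nhds_subtype_eq_comap, Filter.mem_comap] at hW
  obtain ⟨W', hW', hsub⟩ := hW
  filter_upwards [ht hW', e.open_target.mem_nhds (h.mem_target h.mem_source)] with P hP hPt
  refine ⟨hPt, fun h0 => ?_⟩
  have hn : ‖e.symm P‖ = 1 := by
    rw [side, sub_eq_zero] at h0
    exact (pow_eq_one_iff_of_nonneg (norm_nonneg _) two_ne_zero).1 h0
  refine ⟨⟨e.symm P, by simpa using hn⟩, hsub hP, ?_⟩
  rw [← h.apply_coe, e.right_inv hPt]

theorem isCoherent_indexGerm {m : S2 → E 3} {e : S2 → OpenPartialHomeomorph (E 3) (E 3)}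
    (hf : ContMDiff (𝓡 2) 𝓘(ℝ, E 3) ∞ f) (hht : Continuous ht)
    (hemb : ∀ x y, f x = f y → ht x = ht y → x = y) (he : ∀ y, IsCollar f y (m y) (e y))
    (hfin : ∀ x, (above f ht x).Finite) : IsCoherent (indexGerm e hfin) := by
  classical
  intro x
  have hfc : Continuous f := hf.continuous
  obtain ⟨U, hU, hdisj⟩ := (hfin x).t2_separation
  -- Heights in `W y` exceed the midpoint between `x` and `y`, so points of `W y` over `f z` remain
  -- above `z` for `z` near `x`.
  let W : S2 → Set S2 := fun y => U y ∩ interior {u | (u : E 3) ∈ (e y).source ∧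
    (ht x + ht y) / 2 < ht u ∧ ∀ m' e', IsCollar f u m' e' →
      ∀ᶠ P in 𝓝 (f u), 0 < side (e y) P ↔ 0 < side e' P}
  have hWo : ∀ y, IsOpen (W y) := fun y => (hU y).2.inter isOpen_interior
  have hWy : ∀ y ∈ above f ht x, y ∈ W y := by
    intro y hy
    refine ⟨(hU y).1, mem_interior_iff_mem_nhds.2 ?_⟩
    filter_upwards [continuous_subtype_val.continuousAt.eventually
      ((e y).open_source.mem_nhds (he y).mem_source),
      hht.continuousAt.eventually (lt_mem_nhds (by linarith [hy.2] : (ht x + ht y) / 2 < ht y)),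
      (he y).eventually_side_pos_iff hf] with u h1 h2 h3
    exact ⟨h1, h2, h3⟩
  have hev1 : ∀ᶠ z in 𝓝 x, ∀ y ∈ above f ht x, ht z < (ht x + ht y) / 2 :=
    (Filter.eventually_all_finite (hfin x)).2 fun y hy =>
      hht.continuousAt.eventually (gt_mem_nhds (by linarith [hy.2]))
  have hev2 := eventually_above_subset hfc hht hemb he
    (isOpen_biUnion fun y (_ : y ∈ above f ht x) => hWo y)
    (fun y hy => Set.mem_biUnion hy (hWy y hy))
  have hev3 : ∀ᶠ z in 𝓝 x, ∀ y ∈ above f ht x, f z ∈ (e y).target ∧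
      (side (e y) (f z) = 0 → ∃ u ∈ W y, f u = f z) :=
    (Filter.eventually_all_finite (hfin x)).2 fun y hy => by
      have := (he y).eventually_side_eq_zero_imp ((hWo y).mem_nhds (hWy y hy))
      rw [hy.1] at this
      exact hfc.continuousAt.eventually this
  filter_upwards [hev1, hev2, hev3] with z hz1 hz2 hz3
  -- Each branch above `z` is assigned to the branch above `x` that it continues.
  have hg : ∀ y', ∃ y, y' ∈ above f ht z → y ∈ above f ht x ∧ y' ∈ W y := by
    intro y'
    by_cases hy' : y' ∈ above f ht z
    · obtain ⟨y, hy, hyW⟩ := Set.mem_iUnion₂.1 (hz2 hy')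
      exact ⟨y, fun _ => ⟨hy, hyW⟩⟩
    · exact ⟨y', fun h => absurd h hy'⟩
  choose g hg using hg
  have hgW : ∀ y ∈ above f ht x, ∀ y' ∈ above f ht z, y' ∈ W y → g y' = y := by
    intro y hy y' hy' hyW
    by_contra hne
    exact Set.disjoint_left.1 (hdisj (hg y' hy').1 hy hne) (hg y' hy').2.1 hyW.1
  have hlocal : ∀ y, ∃ c : ℤ, y ∈ above f ht x → ∀ᶠ w in 𝓝 z,
      (if 0 < side (e y) (f w) then (1 : ℤ) else 0) =
        (∑ y' ∈ (hfin z).toFinset with g y' = y, if 0 < side (e y') (f w) then 1 else 0) + c := by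
    intro y
    by_cases hy : y ∈ above f ht x
    swap
    · exact ⟨0, fun h => absurd h hy⟩
    obtain ⟨hzt, hz0⟩ := hz3 y hy
    -- If the branch at `y` passes through `f z`, exactly one point above `z` continues it, with the
    -- same sides. Otherwise none does, and its indicator is constant near `z`.
    by_cases h0 : side (e y) (f z) = 0
    · obtain ⟨u, huW, hu⟩ := hz0 h0
      obtain ⟨hus, hult, hucol⟩ := interior_subset huW.2
      have hua : u ∈ above f ht z := ⟨hu, (hz1 y hy).trans hult⟩
      have hfilter : {y' ∈ (hfin z).toFinset | g y' = y} = {u} := by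
        ext y'
        rw [Finset.mem_filter, Set.Finite.mem_toFinset, Finset.mem_singleton]
        constructor
        · rintro ⟨hy', rfl⟩
          have hs := (interior_subset (hg y' hy').2.2).1
          exact (he _).injOn hs hus (hy'.1.trans hu.symm)
        · rintro rfl
          exact ⟨hua, hgW y hy _ hua huW⟩
      refine ⟨0, fun _ => ?_⟩
      rw [hfilter]
      have hev := hucol (m u) (e u) (he u)
      rw [hu] at hev
      filter_upwards [hfc.continuousAt.eventually hev] with w hw
      rw [Finset.sum_singleton, add_zero, if_congr hw rfl rfl]
    · have hfilter : {y' ∈ (hfin z).toFinset | g y' = y} = ∅ := by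
        refine Finset.filter_eq_empty_iff.2 fun y' hy' hgy => h0 ?_
        rw [Set.Finite.mem_toFinset] at hy'
        have hs := (interior_subset (hg y' hy').2.2).1
        rw [hgy] at hs
        rw [← hy'.1, (he y).side_apply hs]
      refine ⟨if 0 < side (e y) (f z) then 1 else 0, fun _ => ?_⟩
      rw [hfilter]
      have hc : ContinuousAt (fun w => side (e y) (f w)) z :=
        ContinuousAt.comp (IsCollar.continuousAt_side (e y) hzt) hfc.continuousAt
      rcases lt_or_gt_of_ne h0 with h | h
      · filter_upwards [hc.eventually (gt_mem_nhds h)] with w hw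
        rw [if_neg hw.not_gt, if_neg h.not_gt, Finset.sum_empty, add_zero]
      · filter_upwards [hc.eventually (lt_mem_nhds h)] with w hw
        rw [if_pos hw, if_pos h, Finset.sum_empty, zero_add]
  choose c hc using hlocal
  refine ⟨∑ y ∈ (hfin x).toFinset, c y, ?_⟩
  filter_upwards [(Filter.eventually_all_finite (hfin x)).2 hc] with w hw
  rw [indexGerm, indexGerm, ← Finset.sum_fiberwise_of_maps_to (s := (hfin z).toFinset)
    (t := (hfin x).toFinset) (g := g) (fun y' hy' => by
      rw [Set.Finite.mem_toFinset] at hy' ⊢; exact (hg y' hy').1), ← Finset.sum_add_distrib]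
  exact Finset.sum_congr rfl fun y hy => hw y ((hfin x).mem_toFinset.1 hy)

end IndexGerm


/-! ### The kink permutation -/

section KinkPerm

variable {R : Type*} [Rack R]

/-- The kink map as a permutation. -/
def kinkPerm : Equiv.Perm R where
  toFun := kink
  invFun a := a ◃ a
  left_inv := kink_self_act
  right_inv := kink_act_self

theorem kinkPerm_zpow_act (k : ℤ) (b a : R) :
    (kinkPerm ^ k) (b ◃ a) = b ◃ (kinkPerm ^ k) a := by
  have h : Commute (kinkPerm : Equiv.Perm R) (Rack.act' b) :=
    Equiv.ext fun a => (act_kink_comm b a).symm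
  exact Equiv.congr_fun (h.zpow_left k).eq a

theorem kinkPerm_zpow_left_act (k : ℤ) (b a : R) : (kinkPerm ^ k) b ◃ a = b ◃ a := by
  induction k with
  | zero => simp
  | succ k ih =>
    rw [add_comm, zpow_one_add, Equiv.Perm.mul_apply]
    exact (kink_act _ _).trans ih
  | pred k ih =>
    have h : (kinkPerm ^ (-(k : ℤ))) b = kinkPerm ((kinkPerm ^ (-(k : ℤ) - 1)) b) := by
      rw [← Equiv.Perm.mul_apply, ← zpow_one_add, add_sub_cancel]
    rw [← ih, h]
    exact (kink_act _ _).symm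

end KinkPerm

/-! ### The index of the sheets and the twist of colorings -/

namespace Diagram

variable {D : Diagram}

theorem map_height_injective {x y : S2} (hm : D.map x = D.map y)
    (hh : D.height x = D.height y) : x = y := by
  apply D.isSmoothEmbedding.isEmbedding.injective
  ext i
  fin_cases i
  · simpa [map, proj] using congrArg (fun p : E 3 => p 0) hm
  · simpa [map, proj] using congrArg (fun p : E 3 => p 1) hm
  · simpa [map, proj] using congrArg (fun p : E 3 => p 2) hm
  · exact hh

theorem continuous_height : Continuous D.height :=
  (EuclideanSpace.proj (3 : Fin 4) : E 4 →L[ℝ] ℝ).continuous.comp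
    D.isSmoothEmbedding.isEmbedding.continuous

theorem finite_above (x : S2) : (above D.map D.height x).Finite :=
  (Set.finite_of_encard_le_coe (D.isGeneric.card_fiber_le (D.map x))).subset fun _ hy => hy.1

theorem above_eq_empty {x : S2} (hx : x ∉ D.lowerSet) : above D.map D.height x = ∅ :=
  Set.eq_empty_of_forall_notMem fun y hy => hx ⟨y, hy⟩

theorem indexGerm_eq_zero {e : S2 → OpenPartialHomeomorph (E 3) (E 3)} {x : S2}
    (hx : x ∉ D.lowerSet) (w : S2) : indexGerm e D.finite_above x w = 0 := by
  simp [indexGerm, above_eq_empty hx]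

open Classical in
theorem indexGerm_of_double {e : S2 → OpenPartialHomeomorph (E 3) (E 3)} {p q : S2}
    (hpq : D.map p = D.map q) (hlt : D.height p < D.height q)
    (h : ∀ z, D.map z = D.map p → z = p ∨ z = q) (w : S2) :
    indexGerm e D.finite_above p w = if 0 < side (e q) (D.map w) then 1 else 0 := by
  have : (D.finite_above p).toFinset = {q} := by
    ext z
    rw [Set.Finite.mem_toFinset, Finset.mem_singleton]
    constructor
    · rintro ⟨hz, hzlt⟩
      exact (h z hz).resolve_left fun hzp => by rw [hzp] at hzlt; exact lt_irrefl _ hzlt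
    · rintro rfl
      exact ⟨hpq.symm, hlt⟩
  rw [indexGerm, this, Finset.sum_singleton]

/-- Without branch points, the sheets carry integers that increase by one across each double point
curve in the direction of the normal of the over-sheet. -/
theorem NoBranchPoints.exists_index (hD : D.NoBranchPoints) :
    ∃ N : D.Sheet → ℤ, ∀ xi xj xk, D.Meet xi xj xk → N xk = N xi + 1 := by
  have hf : ContMDiff (𝓡 2) 𝓘(ℝ, E 3) ∞ D.map := D.isGeneric.contMDiff
  have hcol : ∀ y, ∃ m e, IsCollar D.map y m e := fun y =>
    exists_isCollar hf ((D.isGeneric.regular_or_branch y).resolve_right (hD y))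
  choose m e he using hcol
  obtain ⟨M, hM⟩ := (isCoherent_indexGerm hf D.continuous_height
    (fun _ _ => map_height_injective) he D.finite_above).exists_primitive_sphere
  have hcont : Continuous (fun x : (D.lowerSetᶜ : Set S2) => M x) := by
    refine continuous_iff_continuousAt.2 fun x => ?_
    obtain ⟨c, hc⟩ := hM x
    refine (continuousAt_const (y := c)).congr ?_
    filter_upwards [continuous_subtype_val.continuousAt.eventually hc] with w hw
    rw [hw, indexGerm_eq_zero x.2, zero_add]
  let N : D.Sheet → ℤ := hcont.connectedComponentsLift
  have hN : ∀ (s : D.Sheet) (x : S2), x ∈ s.carrier → N s = M x := by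
    rintro s x ⟨hx, rfl⟩
    exact hcont.connectedComponentsLift_apply_coe _
  refine ⟨N, ?_⟩
  rintro xi xj xk ⟨p, q, hpq, hlt, hdouble, -, n, hn, γ, hγ, hγ0, hpos, hi, hk⟩
  -- `deriv` is zero where the derivative fails to exist, which `hpos` excludes.
  have hdiff : HasDerivAt (fun t => D.map (γ t)) (deriv (fun t => D.map (γ t)) 0) 0 := by
    rw [hasDerivAt_deriv_iff]
    by_contra h
    rw [deriv_zero_of_not_differentiableAt h, inner_zero_left] at hpos
    exact lt_irrefl _ hpos
  obtain ⟨hr, hl⟩ := (he q).eventually_side_pos_of_hasDerivAt hf hn hdiff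
    (by rw [hγ0, hpq]) hpos
  obtain ⟨c, hc⟩ := hM p
  rw [← hγ0] at hc
  have hc' := hγ.continuous.continuousAt.eventually hc
  -- Near `p` the germ is the indicator of the positive side at `q`, with the same `c` before and
  -- after the crossing.
  have hNk : N xk = 1 + c := by
    obtain ⟨t, ht1, ht2, ht3⟩ :=
      (hk.and (hr.and (hc'.filter_mono nhdsWithin_le_nhds))).exists
    rw [hN _ _ ht1, ht3, hγ0, indexGerm_of_double hpq hlt hdouble, if_pos ht2]
  have hNi : N xi = 0 + c := by
    obtain ⟨t, ht1, ht2, ht3⟩ :=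
      (hi.and (hl.and (hc'.filter_mono nhdsWithin_le_nhds))).exists
    rw [hN _ _ ht1, ht3, hγ0, indexGerm_of_double hpq hlt hdouble, if_neg ht2]
  rw [hNk, hNi]
  ring

/-- Twisting the over-sheet does not change its action, and the `ι` in the operation of `Q_R` raises
the exponent `N xi` to `N xk`. So the relation in `Q_R` is the image of that in `R` under the
injective map `ι ^ N xk`. -/
theorem mem_col_iff_twist_mem_col {R : Type*} [Rack R] {N : D.Sheet → ℤ}
    (hN : ∀ xi xj xk, D.Meet xi xj xk → N xk = N xi + 1) (c : D.Sheet → R) :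
    c ∈ D.Col R ↔
      (fun s => (kinkPerm ^ N s) (c s) : D.Sheet → R) ∈ D.Col (AssociatedQuandle R) := by
  refine forall₃_congr fun xi xj xk => forall_congr' fun h => ?_
  have hact : (kinkPerm ^ N xj) (c xj) ◃ kinkPerm ((kinkPerm ^ N xi) (c xi)) =
      (kinkPerm ^ N xk) (c xj ◃ c xi) := by
    rw [kinkPerm_zpow_left_act, kinkPerm_zpow_act, hN xi xj xk h, add_comm, zpow_one_add,
      Equiv.Perm.mul_apply]
  rw [← (kinkPerm ^ N xk).apply_eq_iff_eq (x := c xk), ← hact]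
  rfl

end Diagram

end SurfaceKnot

end

theorem theorem3p3 {R : Type*} [Rack R] (D : SurfaceKnot.Diagram) (hD : D.NoBranchPoints) :
    Nonempty (D.Col R ≃ D.Col (SurfaceKnot.AssociatedQuandle R)) := by
  obtain ⟨N, hN⟩ := hD.exists_index
  exact ⟨(Equiv.piCongrRight fun s => (SurfaceKnot.kinkPerm : Equiv.Perm R) ^ N s).subtypeEquiv
    (SurfaceKnot.Diagram.mem_col_iff_twist_mem_col hN)⟩
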